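/- Let $\Omega$ be a standard Borel space and let $\mathscr C$ be a family of Borel subsets of $\Omega$ (a concept class). Write $P_{na}$ for the set of all non-atomic Borel probability measures on $\Omega$, i.e. those $\mu$ for which every Borel set $A$ with $\mu(A)>0$ contains a Borel set $B$ with $0<\mu(B)<\mu(A)$. Measurability of functions and sets on $\Omega^n$ is understood with respect to the completion of the product measure $\mu^{\otimes n}$. Assume that $\mathscr C$ is universally separable: there is a countable $\mathscr C'\subseteq\mathscr C$ such that every $C\in\mathscr C$ is the pointwise limit of a sequence $(C_k)$ in $\mathscr C'$, i.e. for every $x\in\Omega$ one has $x\in C_k\Leftrightarrow x\in C$ for all sufficiently large $k$. Let $\mathrm{VC}(\mathscr C\,\mathrm{mod}\,\omega_1)$ be the supremum of all natural $n$ for which there are uncountable sets $A_1,\dots,A_n\subseteq\Omega$ such that for each $J\subseteq\{1,\dots,n\}$ some $C\in\mathscr C$ contains all $A_i$, $i\in J$, and is disjoint from all $A_i$, $i\notin J$. Suppose that $d=\mathrm{VC}(\mathscr C\,\mathrm{mod}\,\omega_1)<\infty$. Then, in ZFC without additional set-theoretic assumptions, the following hold. 1. $\mathscr C$ is a uniform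 Glivenko–Cantelli class with regard to $P_{na}$: for every $\varepsilon>0$ the sets below are measurable and $$\sup_{\mu\in P_{na}}\mu^{\otimes n}\Bigl\{\sigma\in\Omega^n:\ \sup_{C\in\mathscr C}|\mu(C)-\mu_n(C)|\ge\varepsilon\Bigr\}\to0\quad(n\to\infty),$$ where $\mu_n(C)=\frac1n\#\{i:\sigma_i\in C\}$ is the empirical measure of the sample $\sigma$. 2. $\mathscr C$ is consistently PAC learnable under $P_{na}$, with the standard sample complexity. Namely, let $\mathcal L:\bigcup_{n\ge1}\Omega^n\times\{0,1\}^n\to\mathscr C$ be any learning rule, i.e. a map such that $\sigma\mapsto\mu(\mathcal L(\sigma,C\cap\sigma)\bigtriangleup C)$ is measurable on $\Omega^n$ for all $C\in\mathscr C$, $\mu\in P_{na}$, $n\ge1$ (where $C\cap\sigma\in\{0,1\}^n$ denotes the labelling of the points of $\sigma$ by membership in $C$), and let $\mathcal L$ be consistent, i.e. $\mathcal L(\sigma,C\cap\sigma)\cap\sigma=C\cap\sigma$ for all $C\in\mathscr C$ and all $\sigma$. Then for every $\varepsilon>0$ $$\sup_{\mu\in P_{na}}\ \sup_{C\in\mathscr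 C}\ \mu^{\otimes n}\bigl\{\sigma\in\Omega^n:\ \mu(\mathcal L(\sigma,C\cap\sigma)\bigtriangleup C)>\varepsilon\bigr\}\to0\quad(n\to\infty).$$ Moreover, for all $0<\varepsilon\le1$, $0<\delta\le1$, all $\mu\in P_{na}$, all $C\in\mathscr C$ and all integers $n\ge1$ with $$n\ \ge\ \frac{128}{\varepsilon^2}\left(d\log\Bigl(\frac{2e^2}{\varepsilon}\log\frac{2e}{\varepsilon}\Bigr)+\log\frac8\delta\right),$$ one has $\mu(\mathcal L(\sigma,C\cap\sigma)\bigtriangleup C)<\varepsilon$ with $\mu^{\otimes n}$-probability at least $1-\delta$. -/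

import Mathlib

open MeasureTheory Filter Topology
open scoped ENNReal symmDiff

noncomputable section

/-- `A 0, …, A (n-1)` is shattered by `𝒞`: for every set `J` of indices some member of `𝒞`
contains all `A i` with `i ∈ J` and is disjoint from all `A i` with `i ∉ J`. -/
def ShattersFamily {Ω : Type*} (𝒞 : Set (Set Ω)) {n : ℕ} (A : Fin n → Set Ω) : Prop :=
  ∀ J : Set (Fin n), ∃ C ∈ 𝒞, (∀ i ∈ J, A i ⊆ C) ∧ (∀ i ∉ J, Disjoint (A i) C)

/-- The VC dimension modulo countable sets: the supremum of the `n` such that some family of `n`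
uncountable subsets of `Ω` is shattered by `𝒞`. -/
def vcDimModCountable {Ω : Type*} (𝒞 : Set (Set Ω)) : ℕ∞ :=
  ⨆ n ∈ {n : ℕ | ∃ A : Fin n → Set Ω, (∀ i, ¬ (A i).Countable) ∧ ShattersFamily 𝒞 A}, (n : ℕ∞)

/-- `𝒞` contains a countable subfamily such that every member of `𝒞` is the pointwise limit of a
sequence from that subfamily. -/
def UniversallySeparable {Ω : Type*} (𝒞 : Set (Set Ω)) : Prop :=
  ∃ 𝒟 : Set (Set Ω), 𝒟 ⊆ 𝒞 ∧ 𝒟.Countable ∧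
    ∀ C ∈ 𝒞, ∃ D : ℕ → Set Ω, (∀ k, D k ∈ 𝒟) ∧
      ∀ x : Ω, ∃ N : ℕ, ∀ k ≥ N, (x ∈ D k ↔ x ∈ C)

/-- The family of all non-atomic probability measures on `Ω`: every set of positive measure
contains a subset of strictly smaller positive measure. -/
def nonatomicMeasures (Ω : Type*) [MeasurableSpace Ω] : Set (ProbabilityMeasure Ω) :=
  {μ | ∀ A : Set Ω, MeasurableSet A → 0 < (μ : Measure Ω) A →
    ∃ B ⊆ A, MeasurableSet B ∧ 0 < (μ : Measure Ω) B ∧ (μ : Measure Ω) B < (μ : Measure Ω) A}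

/-- The law `μ^{⊗ n}` of an i.i.d. sample of size `n`. On a set that is not measurable, its value
is the outer measure; on a set measurable for the completion, it is the completed measure. -/
def sampleLaw {Ω : Type*} [MeasurableSpace Ω] (μ : ProbabilityMeasure Ω) (n : ℕ) :
    Measure (Fin n → Ω) :=
  Measure.pi (fun _ : Fin n => (μ : Measure Ω))

open Classical in
/-- The empirical measure `μ_n(C)` of the set `C` for the sample `σ`. -/
def empiricalFreq {Ω : Type*} {n : ℕ} (σ : Fin n → Ω) (C : Set Ω) : ℝ :=
  ((Finset.univ.filter (fun i : Fin n => σ i ∈ C)).card : ℝ) / (n : ℝ)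

/-- The set of samples with `sup_{C ∈ 𝒞} |μ(C) - μ_n(C)| ≥ ε`. -/
def deviationEvent {Ω : Type*} [MeasurableSpace Ω] (𝒞 : Set (Set Ω)) (μ : ProbabilityMeasure Ω)
    (n : ℕ) (ε : ℝ) : Set (Fin n → Ω) :=
  {σ | ENNReal.ofReal ε ≤
    ⨆ C ∈ 𝒞, ENNReal.ofReal |(μ : Measure Ω).real C - empiricalFreq σ C|}

/-- `𝒞` is uniform Glivenko–Cantelli with regard to `P`: the deviation events are measurable (for
the completed product measures), and their probabilities tend to `0` uniformly over `P`. -/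
def UniformGlivenkoCantelli {Ω : Type*} [MeasurableSpace Ω] (𝒞 : Set (Set Ω))
    (P : Set (ProbabilityMeasure Ω)) : Prop :=
  ∀ ε : ℝ, 0 < ε →
    (∀ μ ∈ P, ∀ n : ℕ, NullMeasurableSet (deviationEvent 𝒞 μ n ε) (sampleLaw μ n)) ∧
    Tendsto (fun n : ℕ => ⨆ μ ∈ P, sampleLaw μ n (deviationEvent 𝒞 μ n ε)) atTop (𝓝 0)

open Classical in
/-- The labels `C ∩ σ` of the points of the sample `σ` given by the concept `C`. -/
def sampleLabels {Ω : Type*} {n : ℕ} (C : Set Ω) (σ : Fin n → Ω) : Fin n → Bool :=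
  fun i => decide (σ i ∈ C)

/-- A learning rule for `𝒞` under `P`: a map assigning a member of `𝒞` to each labelled sample of
size `n ≥ 1`, such that `σ ↦ μ(L(σ, C ∩ σ) ∆ C)` is measurable (for the completion of `μ^{⊗ n}`)
for all `C ∈ 𝒞` and `μ ∈ P`. The value of `hyp` at `n = 0` is irrelevant. -/
structure LearningRule {Ω : Type*} [MeasurableSpace Ω] (𝒞 : Set (Set Ω))
    (P : Set (ProbabilityMeasure Ω)) where
  hyp : (n : ℕ) → (Fin n → Ω) → (Fin n → Bool) → Set Ω
  hyp_mem : ∀ n : ℕ, 1 ≤ n → ∀ (σ : Fin n → Ω) (τ : Fin n → Bool), hyp n σ τ ∈ 𝒞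
  aemeasurable_error : ∀ C ∈ 𝒞, ∀ μ ∈ P, ∀ n : ℕ, 1 ≤ n →
    AEMeasurable (fun σ : Fin n → Ω => (μ : Measure Ω) (hyp n σ (sampleLabels C σ) ∆ C))
      (sampleLaw μ n)

namespace LearningRule

variable {Ω : Type*} [MeasurableSpace Ω] {𝒞 : Set (Set Ω)} {P : Set (ProbabilityMeasure Ω)}

/-- The error `μ(L(σ, C ∩ σ) ∆ C)`. -/
def error (L : LearningRule 𝒞 P) (μ : ProbabilityMeasure Ω) (C : Set Ω) {n : ℕ}
    (σ : Fin n → Ω) : ℝ≥0∞ :=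
  (μ : Measure Ω) (L.hyp n σ (sampleLabels C σ) ∆ C)

/-- `L(σ, C ∩ σ) ∩ σ = C ∩ σ` for all concepts `C` in `𝒞` and all samples `σ`. -/
def Consistent (L : LearningRule 𝒞 P) : Prop :=
  ∀ C ∈ 𝒞, ∀ n : ℕ, 1 ≤ n → ∀ σ : Fin n → Ω, ∀ i : Fin n,
    σ i ∈ L.hyp n σ (sampleLabels C σ) ↔ σ i ∈ C

/-- `L` is probably approximately correct under `P`. -/
def IsPAC (L : LearningRule 𝒞 P) : Prop :=
  ∀ ε : ℝ, 0 < ε →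
    Tendsto (fun n : ℕ => ⨆ μ ∈ P, ⨆ C ∈ 𝒞,
      sampleLaw μ n {σ | ENNReal.ofReal ε < L.error μ C σ}) atTop (𝓝 0)

/-- `L` learns with sample complexity `s`: for each concept in `𝒞` and each `μ ∈ P`, on an i.i.d.
sample of size at least `s ε δ` the error is less than `ε` with confidence at least `1 - δ`. -/
def HasSampleComplexity (L : LearningRule 𝒞 P) (s : ℝ → ℝ → ℝ) : Prop :=
  ∀ ε δ : ℝ, 0 < ε → ε ≤ 1 → 0 < δ → δ ≤ 1 → ∀ n : ℕ, 1 ≤ n → s ε δ ≤ (n : ℝ) →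
    ∀ μ ∈ P, ∀ C ∈ 𝒞,
      sampleLaw μ n {σ | ENNReal.ofReal ε ≤ L.error μ C σ} ≤ ENNReal.ofReal δ

end LearningRule

/-- Every learning rule consistent with `𝒞` is probably approximately correct under `P`. -/
def ConsistentlyLearnable {Ω : Type*} [MeasurableSpace Ω] (𝒞 : Set (Set Ω))
    (P : Set (ProbabilityMeasure Ω)) : Prop :=
  ∀ L : LearningRule 𝒞 P, L.Consistent → L.IsPAC

/-- The standard sample complexity bound
`(128 / ε²) (d log ((2 e² / ε) log (2 e / ε)) + log (8 / δ))`. -/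
def standardSampleComplexity (d : ℕ) (ε δ : ℝ) : ℝ :=
  128 / ε ^ 2 *
    ((d : ℝ) * Real.log (2 * Real.exp 1 ^ 2 / ε * Real.log (2 * Real.exp 1 / ε)) +
      Real.log (8 / δ))

end

/-!
A countable set `N` is null for every measure vanishing on singletons, and outside a suitable such
`N` a universally separable class has ordinary Vapnik–Chervonenkis dimension at most
`vcDimModCountable`. The classical argument then applies on `Nᶜ`, uniformly in the measure: compare
the sample with an independent second one, swap the entries of each pair at random, and combine
Hoeffding's inequality for the random signs with the Sauer–Shelah bound on the number of traces.
Learning reduces to deviations of the class of symmetric differences with the target, which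
shatters the same tuples of points.
-/

section Traces

variable {Ω ι : Type*} {𝒞 𝒟 : Set (Set Ω)}

/-- The traces of the class `𝒞` on the tuple of points `x`, as sets of indices. A tuple all of whose
index sets are traces is shattered by `𝒞`; its points are then distinct. -/
def traces (𝒞 : Set (Set Ω)) (x : ι → Ω) : Set (Set ι) :=
  Set.preimage x '' 𝒞

/-- The class `𝒞` has Vapnik–Chervonenkis dimension at most `d` on `S`: it shatters no `d + 1`
points of `S`. -/
def VCDimOnLE (𝒞 : Set (Set Ω)) (S : Set Ω) (d : ℕ) : Prop :=
  ∀ x : Fin (d + 1) → Ω, (∀ i, x i ∈ S) → traces 𝒞 x ≠ Set.univ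

lemma VCDimOnLE.mono {S : Set Ω} {d : ℕ} (h : VCDimOnLE 𝒞 S d)
    (hsub : ∀ x : Fin (d + 1) → Ω, traces 𝒟 x ⊆ traces 𝒞 x) : VCDimOnLE 𝒟 S d :=
  fun x hx h𝒟 => h x hx (Set.univ_subset_iff.1 (h𝒟.symm.trans_subset (hsub x)))

lemma VCDimOnLE.image_symmDiff {S : Set Ω} {d : ℕ} (h : VCDimOnLE 𝒞 S d) (C : Set Ω) :
    VCDimOnLE ((· ∆ C) '' 𝒞) S d := by
  refine fun x hx hshatters => h x hx (Set.eq_univ_of_forall fun J => ?_)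
  obtain ⟨_, ⟨D, hD, rfl⟩, hDC⟩ := hshatters.symm ▸ Set.mem_univ (J ∆ (x ⁻¹' C))
  exact ⟨D, hD, symmDiff_left_injective (x ⁻¹' C) hDC⟩

lemma VCDimOnLE.vcDim_le {S : Set Ω} {d : ℕ} (h : VCDimOnLE 𝒞 S d) [DecidableEq ι] {x : ι → Ω}
    (hx : ∀ i, x i ∈ S) {𝒜 : Finset (Finset ι)} (h𝒜 : ∀ T ∈ 𝒜, (T : Set ι) ∈ traces 𝒞 x) :
    𝒜.vcDim ≤ d := by
  classical
  refine Finset.sup_le fun s hs => ?_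
  by_contra! hcard
  obtain ⟨e⟩ : Nonempty (Fin (d + 1) ↪ s) :=
    Function.Embedding.nonempty_of_card_le (by simpa using hcard)
  refine h (fun i => x (e i)) (fun i => hx _) (Set.eq_univ_of_forall fun J => ?_)
  obtain ⟨T, hT, hsT⟩ := Finset.mem_shatterer.1 hs
    (t := J.toFinset.image fun i => (e i : ι)) (by simp [Finset.image_subset_iff])
  obtain ⟨C, hC, hCT⟩ := h𝒜 T hT
  refine ⟨C, hC, Set.ext fun i => ?_⟩
  calc x (e i) ∈ C ↔ (e i : ι) ∈ T := by rw [← Finset.mem_coe, ← hCT, Set.mem_preimage]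
    _ ↔ (e i : ι) ∈ s ∩ T := by simp
    _ ↔ i ∈ J := by rw [hsT]; simp

lemma VCDimOnLE.ncard_traces_le [Fintype ι] {S : Set Ω} {d : ℕ} (h : VCDimOnLE 𝒞 S d)
    {x : ι → Ω} (hx : ∀ i, x i ∈ S) :
    (traces 𝒞 x).ncard ≤ ∑ k ∈ Finset.Iic d, (Fintype.card ι).choose k := by
  classical
  let 𝒜 : Finset (Finset ι) := {T | (T : Set ι) ∈ traces 𝒞 x}
  have h𝒜 : ((↑) : Finset ι → Set ι) '' 𝒜 = traces 𝒞 x :=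
    Set.ext fun T => ⟨by rintro ⟨T, hT, rfl⟩; simpa [𝒜] using hT,
      fun hT => ⟨T.toFinset, by simpa [𝒜] using hT, by simp⟩⟩
  have hdim : 𝒜.vcDim ≤ d := h.vcDim_le hx fun T hT => (Finset.mem_filter.1 hT).2
  calc (traces 𝒞 x).ncard = 𝒜.card := by
        rw [← h𝒜, Set.ncard_image_of_injective _ Finset.coe_injective, Set.ncard_coe_finset]
    _ ≤ 𝒜.shatterer.card := 𝒜.card_le_card_shatterer
    _ ≤ ∑ k ∈ Finset.Iic 𝒜.vcDim, (Fintype.card ι).choose k := Finset.card_shatterer_le_sum_vcDim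
    _ ≤ ∑ k ∈ Finset.Iic d, (Fintype.card ι).choose k :=
        Finset.sum_le_sum_of_subset (Finset.Iic_subset_Iic.2 hdim)

lemma sum_choose_le_inv_pow_mul_exp (m d : ℕ) {a : ℝ} (ha : 0 < a) (ha1 : a ≤ 1) :
    (∑ k ∈ Finset.Iic d, m.choose k : ℝ) ≤ a⁻¹ ^ d * Real.exp (m * a) := by
  have hweighted : a ^ d * ∑ k ∈ Finset.Iic d, (m.choose k : ℝ) ≤ Real.exp (m * a) :=
    calc a ^ d * ∑ k ∈ Finset.Iic d, (m.choose k : ℝ)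
        = ∑ k ∈ Finset.Iic d, a ^ d * (m.choose k : ℝ) := Finset.mul_sum ..
      _ ≤ ∑ k ∈ Finset.Iic d, a ^ k * (m.choose k : ℝ) := by
          refine Finset.sum_le_sum fun k hk => mul_le_mul_of_nonneg_right ?_ (Nat.cast_nonneg _)
          exact pow_le_pow_of_le_one ha.le ha1 (Finset.mem_Iic.1 hk)
      _ ≤ ∑ k ∈ Finset.range (m + 1), a ^ k * (m.choose k : ℝ) := by
          have hsupport (k) (_ : k ∈ Finset.Iic d) (hk : a ^ k * (m.choose k : ℝ) ≠ 0) : k ≤ m := by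
            by_contra! hmk
            simp [Nat.choose_eq_zero_of_lt hmk] at hk
          refine (Finset.sum_filter_of_ne hsupport).symm.trans_le
            (Finset.sum_le_sum_of_subset_of_nonneg (fun k hk => ?_) fun k _ _ => by positivity)
          exact Finset.mem_range_succ_iff.2 (Finset.mem_filter.1 hk).2
      _ = (a + 1) ^ m := by simp [add_pow]
      _ ≤ Real.exp a ^ m := by gcongr; exact Real.add_one_le_exp a
      _ = Real.exp (m * a) := (Real.exp_nat_mul a m).symm
  rwa [inv_pow, inv_mul_eq_div, le_div_iff₀' (by positivity)]

end Traces

section UncountableSets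

variable {Ω : Type*} {𝒞 𝒟 : Set (Set Ω)}

lemma ShattersFamily.mono {n : ℕ} {A B : Fin n → Set Ω} (h : ShattersFamily 𝒟 A) (h𝒟 : 𝒟 ⊆ 𝒞)
    (hBA : ∀ i, B i ⊆ A i) : ShattersFamily 𝒞 B := fun J =>
  let ⟨D, hD, hmem, hdisj⟩ := h J
  ⟨D, h𝒟 hD, fun i hi => (hBA i).trans (hmem i hi), fun i hi => (hdisj i hi).mono_left (hBA i)⟩

lemma le_vcDimModCountable {n : ℕ} {A : Fin n → Set Ω} (hA : ∀ i, ¬ (A i).Countable)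
    (h : ShattersFamily 𝒞 A) : n ≤ vcDimModCountable 𝒞 :=
  le_iSup₂_of_le n ⟨A, hA, h⟩ le_rfl

lemma vcDimModCountable_mono (h : 𝒟 ⊆ 𝒞) : vcDimModCountable 𝒟 ≤ vcDimModCountable 𝒞 :=
  iSup₂_le fun _ ⟨_, hA, hshatters⟩ =>
    le_vcDimModCountable hA (hshatters.mono h fun _ => subset_rfl)

/-- If the members `D J` of `𝒟` shatter a tuple `x` via `x ⁻¹' D J = J`, then they also shatter the
family of the cells `{ω | ∀ J, ω ∈ D J ↔ i ∈ J}`, and `x i` lies in the `i`-th cell. So it suffices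
to discard the countable cells, and there are only countably many choices of `D`. -/
lemma exists_countable_vcDimOnLE_compl_of_countable (h𝒟 : 𝒟.Countable) {d : ℕ}
    (hd : vcDimModCountable 𝒟 ≤ d) : ∃ N : Set Ω, N.Countable ∧ VCDimOnLE 𝒟 Nᶜ d := by
  have : Countable 𝒟 := h𝒟.to_subtype
  let cell (D : Set (Fin (d + 1)) → 𝒟) (i : Fin (d + 1)) : Set Ω :=
    {ω | ∀ J, ω ∈ (D J : Set Ω) ↔ i ∈ J}
  refine ⟨⋃ (D) (i) (_ : (cell D i).Countable), cell D i,
    Set.countable_iUnion fun D => Set.countable_iUnion fun i => Set.countable_iUnion id,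
    fun x hx hshatters => ?_⟩
  choose D hD hDx using fun J => (hshatters.symm ▸ Set.mem_univ J : J ∈ traces 𝒟 x)
  let D' : Set (Fin (d + 1)) → 𝒟 := fun J => ⟨D J, hD J⟩
  have hmem_cell (i) : x i ∈ cell D' i := fun J => Set.ext_iff.1 (hDx J) i
  have huncountable (i) : ¬ (cell D' i).Countable := fun hi =>
    hx i (Set.mem_iUnion₂.2 ⟨D', i, Set.mem_iUnion.2 ⟨hi, hmem_cell i⟩⟩)
  have hcells : ShattersFamily 𝒟 (cell D') := fun J =>
    ⟨D J, hD J, fun i hi ω hω => (hω J).2 hi,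
      fun i hi => Set.disjoint_left.2 fun ω hω hωD => hi ((hω J).1 hωD)⟩
  have hle : ((d + 1 : ℕ) : ℕ∞) ≤ d := (le_vcDimModCountable huncountable hcells).trans hd
  exact absurd (Nat.cast_le.1 hle) (Nat.not_succ_le_self d)

end UncountableSets

section RandomSigns

open ProbabilityTheory

/-- The sign carried by a Boolean, `true` standing for a sign change. -/
def boolSign (b : Bool) : ℝ := if b then -1 else 1

lemma abs_boolSign (b : Bool) : |boolSign b| = 1 := by
  cases b <;> simp [boolSign]

/-- The law of a family of independent uniform random bits. -/
noncomputable def uniformBits (ι : Type*) [Fintype ι] : Measure (ι → Bool) :=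
  Measure.pi fun _ => (PMF.uniformOfFintype Bool).toMeasure

variable {ι : Type*} [Fintype ι]

instance : IsProbabilityMeasure (uniformBits ι) :=
  inferInstanceAs (IsProbabilityMeasure (Measure.pi _))

lemma integral_boolSign : ∫ b, boolSign b ∂(PMF.uniformOfFintype Bool).toMeasure = 0 := by
  simp [PMF.integral_eq_sum, boolSign]

lemma hasSubgaussianMGF_boolSign_mul {a : ℝ} (ha : |a| ≤ 1) :
    HasSubgaussianMGF (fun b => boolSign b * a) 1 (PMF.uniformOfFintype Bool).toMeasure := by
  have hmem (b : Bool) : boolSign b * a ∈ Set.Icc (-1) 1 :=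
    abs_le.1 (by rwa [abs_mul, abs_boolSign, one_mul])
  have hmean : ∫ b, boolSign b * a ∂(PMF.uniformOfFintype Bool).toMeasure = 0 := by
    rw [integral_mul_const, integral_boolSign, zero_mul]
  have hparam : (‖(1 : ℝ) - -1‖₊ / 2) ^ 2 = 1 := by ext; norm_num
  exact hparam ▸ hasSubgaussianMGF_of_mem_Icc_of_integral_eq_zero
    (measurable_of_countable _).aemeasurable (.of_forall hmem) hmean

lemma hasSubgaussianMGF_sum_boolSign_mul {a : ι → ℝ} (ha : ∀ i, |a i| ≤ 1) :
    HasSubgaussianMGF (fun s => ∑ i, boolSign (s i) * a i) (Fintype.card ι) (uniformBits ι) := by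
  have hindep : iIndepFun (fun i (s : ι → Bool) => boolSign (s i) * a i) (uniformBits ι) :=
    iIndepFun_pi (X := fun i b => boolSign b * a i) fun i =>
      (measurable_of_countable _).aemeasurable
  have hcoord (i : ι) :
      HasSubgaussianMGF (fun s : ι → Bool => boolSign (s i) * a i) 1 (uniformBits ι) := by
    have hmap : (uniformBits ι).map (fun s => s i) = (PMF.uniformOfFintype Bool).toMeasure :=
      (measurePreserving_eval _ i).map_eq
    refine HasSubgaussianMGF.of_map (X := fun b => boolSign b * a i)
      (measurable_pi_apply i).aemeasurable ?_
    rw [hmap]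
    exact hasSubgaussianMGF_boolSign_mul (ha i)
  simpa using HasSubgaussianMGF.sum_of_iIndepFun hindep (s := Finset.univ) fun i _ => hcoord i

lemma measureReal_abs_ge_le_of_hasSubgaussianMGF {Ω : Type*} [MeasurableSpace Ω] {μ : Measure Ω}
    {X : Ω → ℝ} {c : NNReal} (h : HasSubgaussianMGF X c μ) {r : ℝ} (hr : 0 ≤ r) :
    μ.real {ω | r ≤ |X ω|} ≤ 2 * Real.exp (-r ^ 2 / (2 * c)) := by
  have hunion : {ω | r ≤ |X ω|} = {ω | r ≤ X ω} ∪ {ω | r ≤ (-X) ω} := by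
    ext; simp [le_abs]
  rw [hunion, two_mul]
  exact (measureReal_union_le _ _).trans (add_le_add (h.measure_ge_le hr) (h.neg.measure_ge_le hr))

lemma measureReal_lt_abs_sum_boolSign_mul_le {a : ι → ℝ} (ha : ∀ i, |a i| ≤ 1) {r : ℝ}
    (hr : 0 ≤ r) :
    (uniformBits ι).real {s | Fintype.card ι * r < |∑ i, boolSign (s i) * a i|} ≤
      2 * Real.exp (-(Fintype.card ι * r ^ 2 / 2)) := by
  calc (uniformBits ι).real {s | Fintype.card ι * r < |∑ i, boolSign (s i) * a i|}
      ≤ (uniformBits ι).real {s | Fintype.card ι * r ≤ |∑ i, boolSign (s i) * a i|} :=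
        measureReal_mono <| Set.ofPred_subset_ofPred.2 fun _ => le_of_lt
    _ ≤ 2 * Real.exp (-(Fintype.card ι * r) ^ 2 / (2 * (Fintype.card ι : NNReal))) :=
        measureReal_abs_ge_le_of_hasSubgaussianMGF (hasSubgaussianMGF_sum_boolSign_mul ha)
          (by positivity)
    _ = 2 * Real.exp (-(Fintype.card ι * r ^ 2 / 2)) := by
        rcases eq_or_ne (Fintype.card ι : ℝ) 0 with h0 | h0
        · simp [h0]
        · congr 2; push_cast; field_simp

end RandomSigns

section Swapping

variable {Ω ι : Type*}

/-- Exchange the two members of each pair whose bit is `true`. -/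
def swapPairs (s : ι → Bool) (z : ι → Ω × Ω) : ι → Ω × Ω :=
  fun i => if s i then (z i).swap else z i

/-- The number of first entries (`0` or `1`) minus the number of second entries of the pair `p`
that lie in `D`. -/
noncomputable def pairExcess (D : Set Ω) (p : Ω × Ω) : ℝ :=
  D.indicator 1 p.1 - D.indicator 1 p.2

lemma pairExcess_swapPairs (D : Set Ω) (s : ι → Bool) (z : ι → Ω × Ω) (i : ι) :
    pairExcess D (swapPairs s z i) = boolSign (s i) * pairExcess D (z i) := by
  unfold pairExcess swapPairs boolSign
  split_ifs <;> simp

lemma pairExcess_preimage {Ω' : Type*} (f : Ω' → Ω) (D : Set Ω) (p : Ω' × Ω') :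
    pairExcess (f ⁻¹' D) p = pairExcess D (p.map f f) := rfl

lemma abs_pairExcess_le_one (D : Set Ω) (p : Ω × Ω) : |pairExcess D p| ≤ 1 := by
  classical
  simp only [pairExcess, Set.indicator_apply, Pi.one_apply]
  split_ifs <;> simp

variable [Fintype ι]

variable (ι) in
/-- The pairs of samples indexed by `ι` on which the frequencies of some member of `𝒟` differ by
more than `r`. -/
def pairDeviation (𝒟 : Set (Set Ω)) (r : ℝ) : Set (ι → Ω × Ω) :=
  {z | ∃ D ∈ 𝒟, Fintype.card ι * r < |∑ i, pairExcess D (z i)|}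

lemma measureReal_swapPairs_mem_pairDeviation_le {𝒟 : Set (Set Ω)} {S : Set Ω} {d : ℕ}
    (h𝒟 : VCDimOnLE 𝒟 S d) {z : ι → Ω × Ω} (hz : ∀ i, (z i).1 ∈ S ∧ (z i).2 ∈ S) {r : ℝ}
    (hr : 0 ≤ r) :
    (uniformBits ι).real {s | swapPairs s z ∈ pairDeviation ι 𝒟 r} ≤
      (∑ k ∈ Finset.Iic d, (2 * Fintype.card ι).choose k : ℕ) *
        (2 * Real.exp (-(Fintype.card ι * r ^ 2 / 2))) := by
  let x : ι ⊕ ι → Ω := Sum.elim (fun i => (z i).1) fun i => (z i).2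
  let signedEvent (T : Set (ι ⊕ ι)) : Set (ι → Bool) :=
    {s | Fintype.card ι * r < |∑ i, boolSign (s i) * pairExcess T (Sum.inl i, Sum.inr i)|}
  have hx (j) : x j ∈ S := Sum.rec (fun i => (hz i).1) (fun i => (hz i).2) j
  have hfinite : (traces 𝒟 x).Finite := Set.toFinite _
  have hunion : {s | swapPairs s z ∈ pairDeviation ι 𝒟 r} =
      ⋃ T ∈ hfinite.toFinset, signedEvent T := by
    ext s
    simp [pairDeviation, signedEvent, traces, pairExcess_swapPairs, pairExcess_preimage, x]
  have hcard : (traces 𝒟 x).ncard ≤ ∑ k ∈ Finset.Iic d, (2 * Fintype.card ι).choose k := by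
    simpa [two_mul] using h𝒟.ncard_traces_le hx
  calc (uniformBits ι).real {s | swapPairs s z ∈ pairDeviation ι 𝒟 r}
      ≤ ∑ T ∈ hfinite.toFinset, (uniformBits ι).real (signedEvent T) :=
        hunion ▸ measureReal_biUnion_finset_le _ _
    _ ≤ ∑ T ∈ hfinite.toFinset, 2 * Real.exp (-(Fintype.card ι * r ^ 2 / 2)) :=
        Finset.sum_le_sum fun T _ =>
          measureReal_lt_abs_sum_boolSign_mul_le (fun _ => abs_pairExcess_le_one _ _) hr
    _ = (traces 𝒟 x).ncard * (2 * Real.exp (-(Fintype.card ι * r ^ 2 / 2))) := by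
        rw [Finset.sum_const, nsmul_eq_mul, Set.ncard_eq_toFinset_card _ hfinite]
    _ ≤ _ := by gcongr

variable [MeasurableSpace Ω]

lemma measurable_pairExcess {D : Set Ω} (hD : MeasurableSet D) : Measurable (pairExcess D) :=
  ((measurable_one.indicator hD).comp measurable_fst).sub
    ((measurable_one.indicator hD).comp measurable_snd)

lemma measurableSet_pairDeviation {𝒟 : Set (Set Ω)} (h𝒟 : 𝒟.Countable)
    (hmeas : ∀ D ∈ 𝒟, MeasurableSet D) (r : ℝ) : MeasurableSet (pairDeviation ι 𝒟 r) := by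
  have hunion : pairDeviation ι 𝒟 r =
      ⋃ D ∈ 𝒟, {z | Fintype.card ι * r < |∑ i, pairExcess D (z i)|} := by
    ext; simp [pairDeviation]
  rw [hunion]
  refine MeasurableSet.biUnion h𝒟 fun D hD => measurableSet_lt measurable_const ?_
  exact (Finset.measurable_fun_sum _ fun i _ =>
    (measurable_pairExcess (hmeas D hD)).comp (measurable_pi_apply i)).abs

lemma measurePreserving_swapPairs (μ : Measure Ω) [SigmaFinite μ] (s : ι → Bool) :
    MeasurePreserving (swapPairs s) (Measure.pi fun _ : ι => μ.prod μ)
      (Measure.pi fun _ : ι => μ.prod μ) := by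
  refine measurePreserving_pi (f := fun i (p : Ω × Ω) => if s i then p.swap else p)
    (fun _ => μ.prod μ) (fun _ => μ.prod μ) fun i => ?_
  by_cases h : s i
  · simpa [h] using! Measure.measurePreserving_swap (μ := μ) (ν := μ)
  · simpa [h] using! MeasurePreserving.id (μ.prod μ)

/-- Tonelli: both sides of the conclusion are averages of `ρ {s | g s z ∈ B}` over `z`. -/
lemma measure_le_of_measurePreserving_of_ae_measure_preimage_le {α X Y : Type*}
    [MeasurableSpace α] [MeasurableSpace X] [MeasurableSpace Y] {ρ : Measure α}
    [IsProbabilityMeasure ρ] {ν : Measure X} [IsProbabilityMeasure ν] {ν' : Measure Y}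
    {g : α → X → Y} (hg : Measurable (Function.uncurry g))
    (hpres : ∀ s, MeasurePreserving (g s) ν ν') {B : Set Y}
    (hB : MeasurableSet B) {K : ℝ≥0∞} (hK : ∀ᵐ z ∂ν, ρ {s | g s z ∈ B} ≤ K) :
    ν' B ≤ K := by
  have hpreimage : MeasurableSet (Function.uncurry g ⁻¹' B) := hg hB
  calc ν' B = ∫⁻ s, ν (g s ⁻¹' B) ∂ρ := by
        simp [(hpres _).measure_preimage hB.nullMeasurableSet]
    _ = ∫⁻ z, ρ {s | g s z ∈ B} ∂ν :=
        (Measure.prod_apply hpreimage).symm.trans (Measure.prod_apply_symm hpreimage)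
    _ ≤ ∫⁻ _, K ∂ν := lintegral_mono_ae hK
    _ = K := by simp

lemma measure_pairDeviation_le {𝒟 : Set (Set Ω)} (h𝒟 : 𝒟.Countable)
    (hmeas : ∀ D ∈ 𝒟, MeasurableSet D) {μ : Measure Ω} [IsProbabilityMeasure μ] {S : Set Ω}
    (hS : ∀ᵐ ω ∂μ, ω ∈ S) {d : ℕ} (hdim : VCDimOnLE 𝒟 S d) {r : ℝ} (hr : 0 ≤ r) :
    Measure.pi (fun _ : ι => μ.prod μ) (pairDeviation ι 𝒟 r) ≤
      ENNReal.ofReal ((∑ k ∈ Finset.Iic d, (2 * Fintype.card ι).choose k : ℕ) *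
        (2 * Real.exp (-(Fintype.card ι * r ^ 2 / 2)))) := by
  have hpair : ∀ᵐ p ∂(μ.prod μ), p.1 ∈ S ∧ p.2 ∈ S :=
    (Measure.quasiMeasurePreserving_fst.ae hS).and (Measure.quasiMeasurePreserving_snd.ae hS)
  have hpairs : ∀ᵐ z ∂(Measure.pi fun _ : ι => μ.prod μ), ∀ i, (z i).1 ∈ S ∧ (z i).2 ∈ S :=
    ae_all_iff.2 fun i =>
      (measurePreserving_eval (fun _ : ι => μ.prod μ) i).quasiMeasurePreserving.ae hpair
  refine measure_le_of_measurePreserving_of_ae_measure_preimage_le (ρ := uniformBits ι)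
    (measurable_from_prod_countable_right fun s => (measurePreserving_swapPairs μ s).measurable)
    (measurePreserving_swapPairs μ) (measurableSet_pairDeviation h𝒟 hmeas r)
    (hpairs.mono fun z hz => ?_)
  rw [← ofReal_measureReal]
  exact ENNReal.ofReal_le_ofReal (measureReal_swapPairs_mem_pairDeviation_le hdim hz hr)

end Swapping

section GhostSample

variable {Ω : Type*} {n : ℕ}

lemma empiricalFreq_eq_sum (σ : Fin n → Ω) (D : Set Ω) :
    empiricalFreq σ D = (n : ℝ)⁻¹ * ∑ i, D.indicator 1 (σ i) := by
  classical
  simp [empiricalFreq, Set.indicator_apply, Finset.sum_boole, div_eq_inv_mul]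

lemma empiricalFreq_mem_Icc (σ : Fin n → Ω) (D : Set Ω) : empiricalFreq σ D ∈ Set.Icc 0 1 := by
  classical
  exact ⟨by unfold empiricalFreq; positivity,
    div_le_one_of_le₀ (by exact_mod_cast (Finset.card_le_univ _).trans_eq (Fintype.card_fin n))
      n.cast_nonneg⟩

lemma empiricalFreq_congr {σ : Fin n → Ω} {C D : Set Ω} (h : σ ⁻¹' C = σ ⁻¹' D) :
    empiricalFreq σ C = empiricalFreq σ D := by
  have hmem (i : Fin n) : σ i ∈ C ↔ σ i ∈ D := Set.ext_iff.1 h i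
  classical
  simp only [empiricalFreq_eq_sum, Set.indicator_apply, hmem]

lemma sum_pairExcess_eq (σ σ' : Fin n → Ω) (D : Set Ω) :
    ∑ i, pairExcess D (σ i, σ' i) = n * (empiricalFreq σ D - empiricalFreq σ' D) := by
  rcases eq_or_ne n 0 with rfl | hn
  · simp
  · rw [empiricalFreq_eq_sum, empiricalFreq_eq_sum, ← mul_sub, mul_inv_cancel_left₀ (by simpa),
      ← Finset.sum_sub_distrib]
    rfl

variable [MeasurableSpace Ω]

instance (μ : ProbabilityMeasure Ω) : IsProbabilityMeasure (sampleLaw μ n) :=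
  inferInstanceAs (IsProbabilityMeasure (Measure.pi _))

/-- The distance `|μ(C) - μ_n(C)|` between the measure and the empirical measure of `C`. -/
noncomputable def freqDeviation (μ : ProbabilityMeasure Ω) (σ : Fin n → Ω) (C : Set Ω) : ℝ :=
  |(μ : Measure Ω).real C - empiricalFreq σ C|

/-- The samples of size `n` for which some member of `𝒞` has empirical measure further than `t`
from its measure. Unlike `deviationEvent`, it is a union over `𝒞`. -/
def existsDeviationEvent (𝒞 : Set (Set Ω)) (μ : ProbabilityMeasure Ω) (n : ℕ) (t : ℝ) :
    Set (Fin n → Ω) :=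
  {σ | ∃ C ∈ 𝒞, t < freqDeviation μ σ C}

variable {μ : ProbabilityMeasure Ω} {D : Set Ω} {𝒟 : Set (Set Ω)}

lemma freqDeviation_le_one (μ : ProbabilityMeasure Ω) (σ : Fin n → Ω) (C : Set Ω) :
    freqDeviation μ σ C ≤ 1 :=
  (abs_sub_le_of_le_of_le measureReal_nonneg measureReal_le_one (empiricalFreq_mem_Icc σ C).1
    (empiricalFreq_mem_Icc σ C).2).trans_eq (sub_zero 1)

lemma measurable_empiricalFreq (hD : MeasurableSet D) :
    Measurable fun σ : Fin n → Ω => empiricalFreq σ D := by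
  simp only [empiricalFreq_eq_sum]
  exact (Finset.measurable_fun_sum _ fun i _ =>
    (measurable_one.indicator hD).comp (measurable_pi_apply i)).const_mul _

lemma measurable_freqDeviation (hD : MeasurableSet D) :
    Measurable fun σ : Fin n → Ω => freqDeviation μ σ D :=
  ((measurable_empiricalFreq hD).const_sub _).abs

lemma memLp_indicator_one {ν : Measure Ω} [IsFiniteMeasure ν] (hD : MeasurableSet D)
    (p : ℝ≥0∞) : MemLp (D.indicator (1 : Ω → ℝ)) p ν :=
  memLp_indicator_const p hD 1 (Or.inr (measure_ne_top _ D))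

lemma integral_empiricalFreq (hn : n ≠ 0) (hD : MeasurableSet D) :
    ∫ σ, empiricalFreq σ D ∂sampleLaw μ n = (μ : Measure Ω).real D := by
  have hcoord (i : Fin n) :
      Integrable (fun σ : Fin n → Ω => (D.indicator 1 (σ i) : ℝ)) (sampleLaw μ n) :=
    (measurePreserving_eval (fun _ : Fin n => (μ : Measure Ω)) i).integrable_comp_of_integrable
      (memLp_one_iff_integrable.1 (memLp_indicator_one hD 1))
  have hmean (i : Fin n) :
      ∫ σ : Fin n → Ω, (D.indicator 1 (σ i) : ℝ) ∂sampleLaw μ n = (μ : Measure Ω).real D := by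
    rw [sampleLaw, integral_comp_eval (μ := fun _ : Fin n => (μ : Measure Ω))
      (memLp_indicator_one hD 1).1, integral_indicator_one hD]
  simp only [empiricalFreq_eq_sum, integral_const_mul, integral_finsetSum _ fun i _ => hcoord i,
    hmean, Finset.sum_const, Finset.card_univ, Fintype.card_fin, nsmul_eq_mul]
  exact inv_mul_cancel_left₀ (Nat.cast_ne_zero.2 hn) _

lemma variance_empiricalFreq_le (hD : MeasurableSet D) :
    ProbabilityTheory.variance (fun σ : Fin n → Ω => empiricalFreq σ D) (sampleLaw μ n) ≤
      1 / (4 * n) := by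
  have hindicator : ProbabilityTheory.variance (D.indicator (1 : Ω → ℝ)) (μ : Measure Ω) ≤ 1 / 4 :=
    (ProbabilityTheory.variance_le_sq_of_bounded (a := 0) (b := 1)
      (ae_of_all _ fun ω => ⟨Set.indicator_nonneg (fun _ _ => zero_le_one) ω,
        Set.indicator_le_self' (fun _ _ => zero_le_one) ω⟩)
      (measurable_one.indicator hD).aemeasurable).trans_eq (by norm_num)
  have hsum : (fun σ : Fin n → Ω => ∑ i, (D.indicator 1 (σ i) : ℝ)) =
      ∑ i, fun σ : Fin n → Ω => D.indicator 1 (σ i) := by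
    ext; simp
  calc ProbabilityTheory.variance (fun σ : Fin n → Ω => empiricalFreq σ D) (sampleLaw μ n)
      = ((n : ℝ)⁻¹) ^ 2 *
          ∑ _i : Fin n, ProbabilityTheory.variance (D.indicator (1 : Ω → ℝ)) (μ : Measure Ω) := by
        simp only [empiricalFreq_eq_sum, ProbabilityTheory.variance_const_mul, hsum]
        rw [sampleLaw, ProbabilityTheory.variance_sum_pi fun _ => memLp_indicator_one hD 2]
    _ ≤ ((n : ℝ)⁻¹) ^ 2 * ∑ _i : Fin n, 1 / 4 := by gcongr
    _ = 1 / (4 * n) := by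
        rcases eq_or_ne (n : ℝ) 0 with hn | hn
        · simp [hn]
        · simp; field_simp

lemma sampleLaw_le_freqDeviation_le (hn : n ≠ 0) (hD : MeasurableSet D) {c : ℝ} (hc : 0 < c) :
    sampleLaw μ n {σ | c ≤ freqDeviation μ σ D} ≤ ENNReal.ofReal (1 / (4 * n * c ^ 2)) := by
  have hLp : MemLp (fun σ : Fin n → Ω => empiricalFreq σ D) 2 (sampleLaw μ n) :=
    .of_bound (measurable_empiricalFreq hD).aestronglyMeasurable 1 <| ae_of_all _ fun σ => by
      rw [Real.norm_of_nonneg (empiricalFreq_mem_Icc σ D).1]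
      exact (empiricalFreq_mem_Icc σ D).2
  have hchebyshev := ProbabilityTheory.meas_ge_le_variance_div_sq hLp hc
  simp only [integral_empiricalFreq hn hD, abs_sub_comm _ ((μ : Measure Ω).real D)] at hchebyshev
  refine hchebyshev.trans (ENNReal.ofReal_le_ofReal ?_)
  rw [← div_div]
  gcongr
  exact variance_empiricalFreq_le hD

lemma one_half_le_sampleLaw_freqDeviation_lt (hD : MeasurableSet D) {t : ℝ} (ht : 0 < t)
    (hnt : 2 ≤ n * t ^ 2) : 1 / 2 ≤ sampleLaw μ n {σ | freqDeviation μ σ D < t / 2} := by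
  have hn : n ≠ 0 := by rintro rfl; norm_num at hnt
  have hcompl : {σ : Fin n → Ω | freqDeviation μ σ D < t / 2} =
      {σ | t / 2 ≤ freqDeviation μ σ D}ᶜ := by
    ext; simp
  have htail : sampleLaw μ n {σ | t / 2 ≤ freqDeviation μ σ D} ≤ 1 / 2 := by
    refine (sampleLaw_le_freqDeviation_le hn hD (half_pos ht)).trans
      (ENNReal.ofReal_le_of_le_toReal ?_)
    calc (1 : ℝ) / (4 * n * (t / 2) ^ 2) = 1 / (n * t ^ 2) := by ring
      _ ≤ 1 / 2 := by gcongr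
      _ = (1 / 2 : ℝ≥0∞).toReal := by simp
  rw [hcompl,
    prob_compl_eq_one_sub (measurableSet_le measurable_const (measurable_freqDeviation hD))]
  calc (1 / 2 : ℝ≥0∞) = 1 - 1 / 2 := by simp
    _ ≤ _ := tsub_le_tsub_left htail _

lemma pair_mem_pairDeviation {σ σ' : Fin n → Ω} (hn : n ≠ 0) (hD : D ∈ 𝒟) {t : ℝ}
    (hσ : t < freqDeviation μ σ D) (hσ' : freqDeviation μ σ' D < t / 2) :
    (fun i => (σ i, σ' i)) ∈ pairDeviation (Fin n) 𝒟 (t / 2) := by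
  have hn_pos : (0 : ℝ) < n := by exact_mod_cast Nat.pos_of_ne_zero hn
  refine ⟨D, hD, ?_⟩
  rw [sum_pairExcess_eq, abs_mul, abs_of_pos hn_pos, Fintype.card_fin]
  refine mul_lt_mul_of_pos_left ?_ hn_pos
  have htriangle := abs_sub_le ((μ : Measure Ω).real D) (empiricalFreq σ' D) (empiricalFreq σ D)
  rw [abs_sub_comm (empiricalFreq σ' D)] at htriangle
  simp only [freqDeviation] at hσ hσ'
  linarith

lemma mul_measure_le_prod_of_forall_le_measure_prodMk_preimage {X Y : Type*} [MeasurableSpace X]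
    [MeasurableSpace Y] {ν : Measure X} {ρ : Measure Y} [SFinite ρ] {A : Set X}
    {B : Set (X × Y)} (hB : MeasurableSet B) {c : ℝ≥0∞}
    (h : ∀ x ∈ A, c ≤ ρ (Prod.mk x ⁻¹' B)) : c * ν A ≤ ν.prod ρ B :=
  calc c * ν A ≤ c * ν {x | c ≤ ρ (Prod.mk x ⁻¹' B)} := by gcongr; exact h
    _ ≤ ∫⁻ x, ρ (Prod.mk x ⁻¹' B) ∂ν :=
        mul_meas_ge_le_lintegral (measurable_measure_prodMk_left hB) c
    _ = ν.prod ρ B := (Measure.prod_apply hB).symm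

/-- Symmetrization: with probability at least one half, the frequency of `D` in a second sample is
close to `μ D`, hence far from its frequency in the first. -/
lemma sampleLaw_existsDeviationEvent_le_two_mul (h𝒟 : 𝒟.Countable)
    (hmeas : ∀ D ∈ 𝒟, MeasurableSet D) {t : ℝ} (ht : 0 < t) (hnt : 2 ≤ n * t ^ 2) :
    sampleLaw μ n (existsDeviationEvent 𝒟 μ n t) ≤
      2 * Measure.pi (fun _ : Fin n => (μ : Measure Ω).prod μ)
        (pairDeviation (Fin n) 𝒟 (t / 2)) := by
  have hn : n ≠ 0 := by rintro rfl; norm_num at hnt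
  let e := MeasurableEquiv.arrowProdEquivProdArrow Ω Ω (Fin n)
  have he : MeasurePreserving e (Measure.pi fun _ : Fin n => (μ : Measure Ω).prod μ)
      ((sampleLaw μ n).prod (sampleLaw μ n)) :=
    measurePreserving_arrowProdEquivProdArrow Ω Ω (Fin n) (fun _ => μ) fun _ => μ
  have hfiber : ∀ σ ∈ existsDeviationEvent 𝒟 μ n t,
      1 / 2 ≤ sampleLaw μ n (Prod.mk σ ⁻¹' (e.symm ⁻¹' pairDeviation (Fin n) 𝒟 (t / 2))) := by
    rintro σ ⟨D, hD, hσ⟩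
    exact (one_half_le_sampleLaw_freqDeviation_lt (hmeas D hD) ht hnt).trans
      (measure_mono fun σ' hσ' => pair_mem_pairDeviation hn hD hσ hσ')
  have hhalf := mul_measure_le_prod_of_forall_le_measure_prodMk_preimage (ν := sampleLaw μ n)
    (e.symm.measurable (measurableSet_pairDeviation h𝒟 hmeas _)) hfiber
  rw [(he.symm e).measure_preimage_equiv] at hhalf
  calc sampleLaw μ n (existsDeviationEvent 𝒟 μ n t)
      = 2 * (1 / 2 * sampleLaw μ n (existsDeviationEvent 𝒟 μ n t)) := by
        rw [← mul_assoc, one_div, ENNReal.mul_inv_cancel (by simp) (by simp), one_mul]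
    _ ≤ _ := by gcongr

end GhostSample

section VCInequality

/-- The right-hand side of the Vapnik–Chervonenkis inequality for deviations larger than `t` in a
sample of size `n`. -/
noncomputable def vcBound (d : ℕ) (t : ℝ) (n : ℕ) : ℝ :=
  4 * (32 / t ^ 2) ^ d * Real.exp (-(n * t ^ 2 / 16))

lemma tendsto_vcBound (d : ℕ) {t : ℝ} (ht : t ≠ 0) : Tendsto (vcBound d t) atTop (𝓝 0) := by
  have hlin : Tendsto (fun n : ℕ => n * t ^ 2 / 16) atTop atTop :=
    (tendsto_natCast_atTop_atTop.atTop_mul_const (by positivity)).atTop_div_const (by norm_num)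
  simpa [vcBound, Function.comp_def] using!
    (Real.tendsto_exp_neg_atTop_nhds_zero.comp hlin).const_mul (4 * (32 / t ^ 2) ^ d)

lemma one_le_vcBound (d : ℕ) {t : ℝ} (ht : t ≠ 0) (ht1 : t ^ 2 ≤ 1) {n : ℕ}
    (hnt : n * t ^ 2 ≤ 2) : 1 ≤ vcBound d t n := by
  have hbase : 1 ≤ 32 / t ^ 2 := by rw [le_div_iff₀ (by positivity)]; linarith
  have hexp : 1 / 4 ≤ Real.exp (-(n * t ^ 2 / 16)) :=
    le_trans (by linarith) (Real.add_one_le_exp _)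
  calc (1 : ℝ) = 4 * 1 * (1 / 4) := by norm_num
    _ ≤ vcBound d t n := by unfold vcBound; gcongr; exact one_le_pow₀ hbase

lemma two_mul_sum_choose_mul_exp_le_vcBound (d n : ℕ) {t : ℝ} (ht : t ≠ 0) (ht1 : t ^ 2 ≤ 1) :
    2 * ((∑ k ∈ Finset.Iic d, (2 * n).choose k : ℕ) *
      (2 * Real.exp (-(n * (t / 2) ^ 2 / 2)))) ≤ vcBound d t n := by
  have hsauer := sum_choose_le_inv_pow_mul_exp (2 * n) d (a := t ^ 2 / 32) (by positivity)
    (by linarith)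
  calc 2 * ((∑ k ∈ Finset.Iic d, (2 * n).choose k : ℕ) * (2 * Real.exp (-(n * (t / 2) ^ 2 / 2))))
      ≤ 2 * ((t ^ 2 / 32)⁻¹ ^ d * Real.exp ((2 * n : ℕ) * (t ^ 2 / 32)) *
          (2 * Real.exp (-(n * (t / 2) ^ 2 / 2)))) := by
        push_cast at hsauer ⊢
        gcongr
    _ = 4 * (t ^ 2 / 32)⁻¹ ^ d *
          (Real.exp ((2 * n : ℕ) * (t ^ 2 / 32)) * Real.exp (-(n * (t / 2) ^ 2 / 2))) := by ring
    _ = vcBound d t n := by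
        rw [vcBound, inv_div, ← Real.exp_add]
        congr 2
        push_cast
        ring

variable {Ω : Type*} [MeasurableSpace Ω] {μ : ProbabilityMeasure Ω} {𝒟 : Set (Set Ω)} {S : Set Ω}
  {d : ℕ}

/-- The bound is trivial unless `t ≤ 1` and `2 ≤ n * t ^ 2`. -/
theorem sampleLaw_existsDeviationEvent_le_vcBound_of_countable (h𝒟 : 𝒟.Countable)
    (hmeas : ∀ D ∈ 𝒟, MeasurableSet D) (hS : ∀ᵐ ω ∂(μ : Measure Ω), ω ∈ S)
    (hdim : VCDimOnLE 𝒟 S d) {t : ℝ} (ht : 0 < t) (n : ℕ) :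
    sampleLaw μ n (existsDeviationEvent 𝒟 μ n t) ≤ ENNReal.ofReal (vcBound d t n) := by
  by_cases ht1 : t ≤ 1
  swap
  · have hempty : existsDeviationEvent 𝒟 μ n t = ∅ := Set.eq_empty_of_forall_notMem
      fun σ ⟨D, _, hlt⟩ => ht1 (hlt.le.trans (freqDeviation_le_one μ σ D))
    simp [hempty]
  have ht_sq : t ^ 2 ≤ 1 := pow_le_one₀ ht.le ht1
  rcases le_total (n * t ^ 2) 2 with hnt | hnt
  · exact prob_le_one.trans (ENNReal.one_le_ofReal.2 (one_le_vcBound d ht.ne' ht_sq hnt))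
  · have hpairs := measure_pairDeviation_le (ι := Fin n) h𝒟 hmeas hS hdim (half_pos ht).le
    rw [Fintype.card_fin] at hpairs
    calc sampleLaw μ n (existsDeviationEvent 𝒟 μ n t)
        ≤ 2 * Measure.pi (fun _ : Fin n => (μ : Measure Ω).prod μ)
            (pairDeviation (Fin n) 𝒟 (t / 2)) :=
          sampleLaw_existsDeviationEvent_le_two_mul h𝒟 hmeas ht hnt
      _ ≤ 2 * ENNReal.ofReal ((∑ k ∈ Finset.Iic d, (2 * n).choose k : ℕ) *
            (2 * Real.exp (-(n * (t / 2) ^ 2 / 2)))) := by gcongr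
      _ = ENNReal.ofReal (2 * ((∑ k ∈ Finset.Iic d, (2 * n).choose k : ℕ) *
            (2 * Real.exp (-(n * (t / 2) ^ 2 / 2))))) := by
          rw [ENNReal.ofReal_mul zero_le_two, ENNReal.ofReal_ofNat]
      _ ≤ ENNReal.ofReal (vcBound d t n) := ENNReal.ofReal_le_ofReal
          (two_mul_sum_choose_mul_exp_le_vcBound d n ht.ne' ht_sq)

end VCInequality

section PointwiseLimits

variable {Ω : Type*} {𝒞 𝒟 : Set (Set Ω)} {C : Set Ω}

/-- `C` is the pointwise limit of a sequence from `𝒟`, as in `UniversallySeparable`. -/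
def IsPointwiseLimit (𝒟 : Set (Set Ω)) (C : Set Ω) : Prop :=
  ∃ D : ℕ → Set Ω, (∀ k, D k ∈ 𝒟) ∧ ∀ x : Ω, ∃ N : ℕ, ∀ k ≥ N, (x ∈ D k ↔ x ∈ C)

lemma eventually_preimage_eq {ι : Type*} [Finite ι] {D : ℕ → Set Ω}
    (hDC : ∀ x, ∃ N, ∀ k ≥ N, (x ∈ D k ↔ x ∈ C)) (x : ι → Ω) :
    ∀ᶠ k in atTop, x ⁻¹' D k = x ⁻¹' C :=
  (eventually_all.2 fun i => eventually_atTop.2 (hDC (x i))).mono fun _ hk => Set.ext hk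

lemma traces_subset_of_isPointwiseLimit {ι : Type*} [Finite ι]
    (hlim : ∀ C ∈ 𝒞, IsPointwiseLimit 𝒟 C) (x : ι → Ω) : traces 𝒞 x ⊆ traces 𝒟 x := by
  rintro _ ⟨C, hC, rfl⟩
  obtain ⟨D, hD, hDC⟩ := hlim C hC
  obtain ⟨k, hk⟩ := (eventually_preimage_eq hDC x).exists
  exact ⟨D k, hD k, hk⟩

theorem UniversallySeparable.exists_countable_vcDimOnLE_compl (h : UniversallySeparable 𝒞) {d : ℕ}
    (hd : vcDimModCountable 𝒞 ≤ d) : ∃ N : Set Ω, N.Countable ∧ VCDimOnLE 𝒞 Nᶜ d := by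
  obtain ⟨𝒟, hsub, h𝒟, hlim⟩ := h
  obtain ⟨N, hN, hdim⟩ := exists_countable_vcDimOnLE_compl_of_countable h𝒟
    ((vcDimModCountable_mono hsub).trans hd)
  exact ⟨N, hN, hdim.mono (traces_subset_of_isPointwiseLimit hlim)⟩

lemma UniversallySeparable.image_symmDiff (h : UniversallySeparable 𝒞) (C : Set Ω) :
    UniversallySeparable ((· ∆ C) '' 𝒞) := by
  obtain ⟨𝒟, hsub, h𝒟, hlim⟩ := h
  refine ⟨(· ∆ C) '' 𝒟, Set.image_mono hsub, h𝒟.image _, ?_⟩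
  rintro _ ⟨E, hE, rfl⟩
  obtain ⟨D, hD, hDE⟩ := hlim E hE
  refine ⟨fun k => D k ∆ C, fun k => Set.mem_image_of_mem _ (hD k), fun x => ?_⟩
  obtain ⟨N, hN⟩ := hDE x
  exact ⟨N, fun k hk => by simp only [Set.mem_symmDiff, hN k hk]⟩

variable [MeasurableSpace Ω] {μ : ProbabilityMeasure Ω} {n : ℕ}

lemma tendsto_freqDeviation {D : ℕ → Set Ω} (hmeas : ∀ k, MeasurableSet (D k))
    (hDC : ∀ x, ∃ N, ∀ k ≥ N, (x ∈ D k ↔ x ∈ C)) (μ : ProbabilityMeasure Ω) (σ : Fin n → Ω) :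
    Tendsto (fun k => freqDeviation μ σ (D k)) atTop (𝓝 (freqDeviation μ σ C)) := by
  have hmeasure :
      Tendsto (fun k => (μ : Measure Ω).real (D k)) atTop (𝓝 ((μ : Measure Ω).real C)) :=
    (ENNReal.tendsto_toReal (measure_ne_top _ C)).comp
      (tendsto_measure_of_tendsto_indicator_of_isFiniteMeasure atTop _ hmeas
        fun x => eventually_atTop.2 (hDC x))
  have hfreq : ∀ᶠ k in atTop, empiricalFreq σ C = empiricalFreq σ (D k) :=
    (eventually_preimage_eq hDC σ).mono fun k hk => empiricalFreq_congr hk.symm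
  exact (hmeasure.sub (tendsto_const_nhds.congr' hfreq)).abs

lemma existsDeviationEvent_subset (hmeas : ∀ D ∈ 𝒟, MeasurableSet D)
    (hlim : ∀ C ∈ 𝒞, IsPointwiseLimit 𝒟 C) (μ : ProbabilityMeasure Ω) (n : ℕ) (t : ℝ) :
    existsDeviationEvent 𝒞 μ n t ⊆ existsDeviationEvent 𝒟 μ n t := by
  rintro σ ⟨C, hC, hlt⟩
  obtain ⟨D, hD, hDC⟩ := hlim C hC
  obtain ⟨k, hk⟩ :=
    ((tendsto_freqDeviation (fun k => hmeas _ (hD k)) hDC μ σ).eventually_const_lt hlt).exists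
  exact ⟨D k, hD k, hk⟩

lemma UniversallySeparable.measurableSet_deviationEvent (h : UniversallySeparable 𝒞)
    (hmeas : ∀ C ∈ 𝒞, MeasurableSet C) (μ : ProbabilityMeasure Ω) (n : ℕ) (ε : ℝ) :
    MeasurableSet (deviationEvent 𝒞 μ n ε) := by
  obtain ⟨𝒟, hsub, h𝒟, hlim⟩ := h
  have hsup (σ : Fin n → Ω) : ⨆ C ∈ 𝒞, ENNReal.ofReal (freqDeviation μ σ C) =
      ⨆ D ∈ 𝒟, ENNReal.ofReal (freqDeviation μ σ D) := by
    refine le_antisymm (iSup₂_le fun C hC => ?_) (biSup_mono fun D hD => hsub hD)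
    obtain ⟨D, hD, hDC⟩ := hlim C hC
    exact le_of_tendsto' (ENNReal.tendsto_ofReal
      (tendsto_freqDeviation (fun k => hmeas _ (hsub (hD k))) hDC μ σ))
      fun k => le_iSup₂_of_le (D k) (hD k) le_rfl
  have hevent : deviationEvent 𝒞 μ n ε =
      {σ | ENNReal.ofReal ε ≤ ⨆ D ∈ 𝒟, ENNReal.ofReal (freqDeviation μ σ D)} :=
    Set.ext fun σ => by rw [Set.mem_ofPred_eq, ← hsup]; rfl
  rw [hevent]
  exact measurableSet_le measurable_const
    (Measurable.biSup 𝒟 h𝒟 fun D hD =>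
      (measurable_freqDeviation (hmeas D (hsub hD))).ennreal_ofReal)

theorem sampleLaw_existsDeviationEvent_le_vcBound (hsep : UniversallySeparable 𝒞)
    (hmeas : ∀ C ∈ 𝒞, MeasurableSet C) {S : Set Ω} (hS : ∀ᵐ ω ∂(μ : Measure Ω), ω ∈ S) {d : ℕ}
    (hdim : VCDimOnLE 𝒞 S d) {t : ℝ} (ht : 0 < t) (n : ℕ) :
    sampleLaw μ n (existsDeviationEvent 𝒞 μ n t) ≤ ENNReal.ofReal (vcBound d t n) := by
  obtain ⟨𝒟, hsub, h𝒟, hlim⟩ := hsep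
  have hmeas𝒟 : ∀ D ∈ 𝒟, MeasurableSet D := fun D hD => hmeas D (hsub hD)
  exact (measure_mono (existsDeviationEvent_subset hmeas𝒟 hlim μ n t)).trans
    (sampleLaw_existsDeviationEvent_le_vcBound_of_countable h𝒟 hmeas𝒟 hS
      (hdim.mono fun _ => Set.image_mono hsub) ht n)

end PointwiseLimits

section Learning

variable {Ω : Type*} [MeasurableSpace Ω] {𝒞 : Set (Set Ω)} {μ : ProbabilityMeasure Ω} {S : Set Ω}
  {d : ℕ}

lemma deviationEvent_subset_existsDeviationEvent {n : ℕ} {s t : ℝ} (ht : 0 < t) (hst : s < t) :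
    deviationEvent 𝒞 μ n t ⊆ existsDeviationEvent 𝒞 μ n s := by
  intro σ hσ
  have hlt := ((ENNReal.ofReal_lt_ofReal_iff ht).2 hst).trans_le hσ
  simp only [lt_iSup_iff] at hlt
  obtain ⟨C, hC, hlt⟩ := hlt
  exact ⟨C, hC, lt_of_not_ge fun hle => hlt.not_ge (ENNReal.ofReal_le_ofReal hle)⟩

lemma tendsto_zero_of_le_vcBound {f : ℕ → ℝ≥0∞} {t : ℝ} (ht : t ≠ 0)
    (h : ∀ᶠ n in atTop, f n ≤ ENNReal.ofReal (vcBound d t n)) : Tendsto f atTop (𝓝 0) := by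
  have hbound : Tendsto (fun n => ENNReal.ofReal (vcBound d t n)) atTop (𝓝 0) := by
    simpa using ENNReal.tendsto_ofReal (tendsto_vcBound d ht)
  exact tendsto_of_tendsto_of_tendsto_of_le_of_le' tendsto_const_nhds hbound
    (.of_forall fun _ => zero_le) h

theorem uniformGlivenkoCantelli_of_vcDimOnLE {P : Set (ProbabilityMeasure Ω)}
    (hsep : UniversallySeparable 𝒞) (hmeas : ∀ C ∈ 𝒞, MeasurableSet C)
    (hP : ∀ μ ∈ P, ∀ᵐ ω ∂(μ : Measure Ω), ω ∈ S) (hdim : VCDimOnLE 𝒞 S d) :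
    UniformGlivenkoCantelli 𝒞 P := fun ε hε =>
  ⟨fun μ _ n => (hsep.measurableSet_deviationEvent hmeas μ n ε).nullMeasurableSet,
    tendsto_zero_of_le_vcBound (half_pos hε).ne' <| .of_forall fun n => iSup₂_le fun μ hμ =>
      (measure_mono (deviationEvent_subset_existsDeviationEvent hε (half_lt_self hε))).trans
        (sampleLaw_existsDeviationEvent_le_vcBound hsep hmeas (hP μ hμ) hdim (half_pos hε) n)⟩

namespace LearningRule

variable {P : Set (ProbabilityMeasure Ω)} {L : LearningRule 𝒞 P}

/-- A consistent hypothesis agrees with the target on the sample, so its symmetric difference with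
the target has frequency zero. -/
lemma Consistent.setOf_le_error_subset (hL : L.Consistent) {C : Set Ω} (hC : C ∈ 𝒞) {n : ℕ}
    (hn : 1 ≤ n) {s t : ℝ} (hst : s < t) :
    {σ : Fin n → Ω | ENNReal.ofReal t ≤ L.error μ C σ} ⊆
      existsDeviationEvent ((· ∆ C) '' 𝒞) μ n s := by
  intro σ hσ
  refine ⟨_, ⟨L.hyp n σ (sampleLabels C σ), L.hyp_mem n hn _ _, rfl⟩, ?_⟩
  have hagree : σ ⁻¹' (L.hyp n σ (sampleLabels C σ) ∆ C) = σ ⁻¹' ∅ :=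
    Set.ext fun i => by simp [Set.mem_symmDiff, hL C hC n hn σ i]
  have herror : freqDeviation μ σ (L.hyp n σ (sampleLabels C σ) ∆ C) =
      (L.error μ C σ).toReal := by
    rw [freqDeviation, empiricalFreq_congr hagree]
    simp [empiricalFreq, error, Measure.real]
  exact hst.trans_le
    (((ENNReal.ofReal_le_iff_le_toReal (measure_ne_top _ _)).1 hσ).trans_eq herror.symm)

theorem Consistent.sampleLaw_le_error_le (hL : L.Consistent) (hsep : UniversallySeparable 𝒞)
    (hmeas : ∀ C ∈ 𝒞, MeasurableSet C) (hS : ∀ᵐ ω ∂(μ : Measure Ω), ω ∈ S)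
    (hdim : VCDimOnLE 𝒞 S d) {C : Set Ω} (hC : C ∈ 𝒞) {n : ℕ} (hn : 1 ≤ n) {ε : ℝ} (hε : 0 < ε) :
    sampleLaw μ n {σ | ENNReal.ofReal ε ≤ L.error μ C σ} ≤
      ENNReal.ofReal (vcBound d (ε / 2) n) := by
  have hmeas' : ∀ E ∈ (· ∆ C) '' 𝒞, MeasurableSet E := by
    rintro _ ⟨D, hD, rfl⟩
    exact (hmeas D hD).symmDiff (hmeas C hC)
  exact (measure_mono (hL.setOf_le_error_subset hC hn (half_lt_self hε))).trans
    (sampleLaw_existsDeviationEvent_le_vcBound (hsep.image_symmDiff C) hmeas' hS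
      (hdim.image_symmDiff C) (half_pos hε) n)

theorem Consistent.isPAC (hL : L.Consistent) (hsep : UniversallySeparable 𝒞)
    (hmeas : ∀ C ∈ 𝒞, MeasurableSet C) (hP : ∀ μ ∈ P, ∀ᵐ ω ∂(μ : Measure Ω), ω ∈ S)
    (hdim : VCDimOnLE 𝒞 S d) : L.IsPAC := fun _ hε =>
  tendsto_zero_of_le_vcBound (half_pos hε).ne' <| (eventually_ge_atTop 1).mono fun _ hn =>
    iSup₂_le fun μ hμ => iSup₂_le fun _ hC =>
      (measure_mono <| Set.ofPred_subset_ofPred.2 fun _ => le_of_lt).trans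
        (hL.sampleLaw_le_error_le hsep hmeas (hP μ hμ) hdim hC hn hε)

end LearningRule

lemma twelve_div_le_mul_log {ε : ℝ} (hε : 0 < ε) (hε1 : ε ≤ 1) :
    12 / ε ≤ 2 * Real.exp 1 ^ 2 / ε * Real.log (2 * Real.exp 1 / ε) := by
  have hexp : 2.7 ≤ Real.exp 1 := by linarith [Real.exp_one_gt_d9]
  have hlog : 1 ≤ Real.log (2 * Real.exp 1 / ε) := by
    rw [Real.le_log_iff_exp_le (by positivity), le_div_iff₀ hε]
    nlinarith
  calc 12 / ε ≤ 2 * Real.exp 1 ^ 2 / ε := by gcongr; nlinarith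
    _ ≤ 2 * Real.exp 1 ^ 2 / ε * Real.log (2 * Real.exp 1 / ε) :=
        le_mul_of_one_le_right (by positivity) hlog

lemma vcBound_half_le_of_standardSampleComplexity_le {n : ℕ} {ε δ : ℝ} (hε : 0 < ε) (hε1 : ε ≤ 1)
    (hδ : 0 < δ) (hδ1 : δ ≤ 1) (h : standardSampleComplexity d ε δ ≤ n) :
    vcBound d (ε / 2) n ≤ δ := by
  set q := 2 * Real.exp 1 ^ 2 / ε * Real.log (2 * Real.exp 1 / ε) with hq
  have hq12 : 12 / ε ≤ q := twelve_div_le_mul_log hε hε1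
  have hq_pos : 0 < q := lt_of_lt_of_le (by positivity) hq12
  have hlogδ : 0 ≤ Real.log (8 / δ) := Real.log_nonneg (by rw [le_div_iff₀ hδ]; linarith)
  have hn : 128 * (d * Real.log q + Real.log (8 / δ)) ≤ n * ε ^ 2 := by
    rwa [standardSampleComplexity, ← hq, div_mul_eq_mul_div, div_le_iff₀ (by positivity)] at h
  have hbase : 32 / (ε / 2) ^ 2 ≤ q ^ 2 :=
    calc 32 / (ε / 2) ^ 2 ≤ (12 / ε) ^ 2 := by
          rw [div_pow, div_pow, div_div_eq_mul_div]; gcongr; norm_num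
      _ ≤ q ^ 2 := by gcongr
  have hpow : (q ^ 2) ^ d = Real.exp (2 * (d * Real.log q)) := by
    rw [← pow_mul, ← Real.exp_log (pow_pos hq_pos (2 * d)), Real.log_pow]
    push_cast
    ring_nf
  calc vcBound d (ε / 2) n
      ≤ 4 * (q ^ 2) ^ d *
          Real.exp (-(2 * (d * Real.log q)) + -Real.log (8 / δ)) := by
        unfold vcBound
        gcongr
        linarith
    _ = 4 * Real.exp (-Real.log (8 / δ)) := by
        rw [hpow, Real.exp_add, ← mul_assoc, mul_assoc 4, ← Real.exp_add, add_neg_cancel,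
          Real.exp_zero, mul_one]
    _ = δ / 2 := by
        rw [Real.exp_neg, Real.exp_log (by positivity), inv_div]
        ring
    _ ≤ δ := half_le_self hδ.le

theorem LearningRule.Consistent.hasSampleComplexity {P : Set (ProbabilityMeasure Ω)}
    {L : LearningRule 𝒞 P} (hL : L.Consistent) (hsep : UniversallySeparable 𝒞)
    (hmeas : ∀ C ∈ 𝒞, MeasurableSet C) (hP : ∀ μ ∈ P, ∀ᵐ ω ∂(μ : Measure Ω), ω ∈ S)
    (hdim : VCDimOnLE 𝒞 S d) : L.HasSampleComplexity (standardSampleComplexity d) :=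
  fun _ _ hε hε1 hδ hδ1 _ hn hle μ hμ _ hC =>
    (hL.sampleLaw_le_error_le hsep hmeas (hP μ hμ) hdim hC hn hε).trans
      (ENNReal.ofReal_le_ofReal (vcBound_half_le_of_standardSampleComplexity_le hε hε1 hδ hδ1 hle))

end Learning

theorem mainTheorem6_general {Ω : Type*} [MeasurableSpace Ω] (𝒞 : Set (Set Ω))
    (hmeas : ∀ C ∈ 𝒞, MeasurableSet C) (hsep : UniversallySeparable 𝒞) (d : ℕ)
    (hd : vcDimModCountable 𝒞 ≤ d) (P : Set (ProbabilityMeasure Ω))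
    (hP : ∀ μ ∈ P, NullSingletonClass (μ : Measure Ω)) :
    UniformGlivenkoCantelli 𝒞 P ∧ ConsistentlyLearnable 𝒞 P ∧
      ∀ L : LearningRule 𝒞 P, L.Consistent →
        L.HasSampleComplexity (standardSampleComplexity d) := by
  obtain ⟨N, hN, hdim⟩ := hsep.exists_countable_vcDimOnLE_compl hd
  have hNc : ∀ μ ∈ P, ∀ᵐ ω ∂(μ : Measure Ω), ω ∈ Nᶜ := fun μ hμ =>
    have := hP μ hμ
    hN.ae_notMem _
  exact ⟨uniformGlivenkoCantelli_of_vcDimOnLE hsep hmeas hNc hdim,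
    fun _ hL => hL.isPAC hsep hmeas hNc hdim,
    fun _ hL => hL.hasSampleComplexity hsep hmeas hNc hdim⟩

lemma nullSingletonClass_of_mem_nonatomicMeasures {Ω : Type*} [MeasurableSpace Ω]
    [MeasurableSingletonClass Ω] {μ : ProbabilityMeasure Ω} (hμ : μ ∈ nonatomicMeasures Ω) :
    NullSingletonClass (μ : Measure Ω) where
  measure_singleton x := by
    by_contra hx
    obtain ⟨B, hB, -, hpos, hlt⟩ := hμ {x} (measurableSet_singleton x) (pos_iff_ne_zero.2 hx)
    rcases Set.subset_singleton_iff_eq.1 hB with rfl | rfl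
    · exact hpos.ne' measure_empty
    · exact hlt.false

theorem mainTheorem6 {Ω : Type*} [MeasurableSpace Ω] [StandardBorelSpace Ω]
    (𝒞 : Set (Set Ω)) (hmeas : ∀ C ∈ 𝒞, MeasurableSet C)
    (hsep : UniversallySeparable 𝒞)
    (d : ℕ) (hd : vcDimModCountable 𝒞 = (d : ℕ∞)) :
    UniformGlivenkoCantelli 𝒞 (nonatomicMeasures Ω) ∧
    ConsistentlyLearnable 𝒞 (nonatomicMeasures Ω) ∧
    ∀ L : LearningRule 𝒞 (nonatomicMeasures Ω), L.Consistent →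
      L.HasSampleComplexity (standardSampleComplexity d) :=
  mainTheorem6_general 𝒞 hmeas hsep d hd.le _ fun _ =>
    nullSingletonClass_of_mem_nonatomicMeasures
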